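/- Let $\mathcal{L}$ be a countable first-order language, $\kappa$ an uncountable cardinal and $\mathcal{U}$ a $\kappa$-saturated $\mathcal{L}$-structure (for instance a monster model of a complete $\mathcal{L}$-theory). Let $M \prec \mathcal{U}$ be a small elementary submodel, i.e. $|M| < \kappa$ ($M$ is not assumed countable), let $x, y$ be finite tuples of variables, and let $\varphi(x,y)$ be a formula with parameters in $M$. Let $\mathcal{L}_\varphi(\mathcal{U})$ be the Boolean algebra of subsets of $\mathcal{U}^x$ generated by the sets $\varphi(x,b)$, $b \in \mathcal{U}^y$, and let $\mu$ be a $\varphi$-measure, i.e. a finitely additive probability measure on $\mathcal{L}_\varphi(\mathcal{U})$. Assume that 1. $\varphi(x;y)$ is NIP: there is $k \in \mathbb{N}$ such that no $k$ points of $\mathcal{U}^x$ are shattered by the family $\{\varphi(x,b) : b \in \mathcal{U}^y\}$; 2. $\mu$ is $\varphi$-definable over $M$: if $\operatorname{tp}(b/M) = \operatorname{tp}(c/M)$ then $\mu(\varphi(x,b)) = \mu(\varphi(x,c))$, and the map $S_y(M) \to [0,1]$, $\operatorname{tp}(b/M) \mapsto \mu(\varphi(x,b))$, is continuous; 3. $\mu$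 is finitely satisfiable in $M$: every $\theta \in \mathcal{L}_\varphi(\mathcal{U})$ with $\mu(\theta) > 0$ contains a point of $M^x$. Then for every $\varepsilon > 0$ there are $n \ge 1$ and $a_1, \dots, a_n \in M^x$ such that $$\sup_{b \in \mathcal{U}^y} \bigl| \mu(\varphi(x,b)) - \operatorname{Av}(\bar a)(\varphi(x,b)) \bigr| < \varepsilon, \qquad \operatorname{Av}(\bar a)(\varphi(x,b)) = \frac{|\{ i \le n : \mathcal{U} \models \varphi(a_i,b)\}|}{n}.$$ -/

import Mathlib

open FirstOrder FirstOrder.Language MeasureTheory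
open scoped Cardinal NNReal

universe u v w

namespace LocalKeisler

variable {L : FirstOrder.Language.{u, v}} {U : Type w} [L.Structure U] [Nonempty U]

/-- `S_n(A)`: the space of complete types in `n` variables over the parameter set `A ⊆ U`, that is,
complete types of the elementary diagram of `A` in `U`, with its usual (Stone) topology. -/
abbrev TypeSpace (L : FirstOrder.Language.{u, v}) {U : Type w} [L.Structure U]
    (A : Set U) (n : ℕ) :=
  (L[[A]].completeTheory U).CompleteType (Fin n)

/-- `tp(b/A)`. -/
def tp (L : FirstOrder.Language.{u, v}) {U : Type w} [L.Structure U] [Nonempty U]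
    (A : Set U) {n : ℕ} (b : Fin n → U) : TypeSpace L A n :=
  (L[[A]].completeTheory U).typeOf b

/-- `U` is `κ`-saturated: every complete type in finitely many variables over a set of fewer
than `κ` parameters is realized in `U`. -/
def IsSaturated (L : FirstOrder.Language.{u, v}) (U : Type w) [L.Structure U] [Nonempty U]
    (κ : Cardinal.{w}) : Prop :=
  ∀ A : Set U, #A < κ → ∀ (n : ℕ) (q : TypeSpace L A n), ∃ b : Fin n → U, tp L A b = q

section Formula

variable {A : Set U} {m n : ℕ}

/-- For a partitioned formula `φ(x, y)` with parameters in `A`, the subset of `U^x` defined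
by `φ(x, b)`. -/
def fiber (φ : L[[A]].Formula (Fin m ⊕ Fin n)) (b : Fin n → U) : Set (Fin m → U) :=
  {a | φ.Realize (Sum.elim a b)}

/-- `φ(x; y)` is NIP: for some `k`, no `k` points of `U^x` are shattered by the sets `φ(x, b)`
with `b ∈ U^y`. -/
def IsNIP (φ : L[[A]].Formula (Fin m ⊕ Fin n)) : Prop :=
  ∃ k : ℕ, ¬ ∃ a : Fin k → Fin m → U,
    ∀ I : Set (Fin k), ∃ b : Fin n → U, ∀ i, a i ∈ fiber φ b ↔ i ∈ I

/-- The Boolean algebra of subsets of `U^x` generated by the sets `φ(x, b)`, `b ∈ U^y`. -/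
def localAlgebra (φ : L[[A]].Formula (Fin m ⊕ Fin n)) : Set (Set (Fin m → U)) :=
  generateSetAlgebra (Set.range (fiber φ))

/-- A `φ`-measure: a finitely additive probability measure on `localAlgebra φ`. (The values of the
underlying function outside this algebra carry no information and are never used.) -/
structure LocalMeasure (φ : L[[A]].Formula (Fin m ⊕ Fin n)) where
  toAddContent : AddContent ℝ≥0 (localAlgebra φ)
  map_univ : toAddContent Set.univ = 1

namespace LocalMeasure

variable {φ : L[[A]].Formula (Fin m ⊕ Fin n)}

/-- The real number `μ(s)`. -/
def measure (μ : LocalMeasure φ) (s : Set (Fin m → U)) : ℝ := (μ.toAddContent s : ℝ)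

/-- `(A, φ)`-invariance, where `A` contains the parameters of `φ`. -/
def IsInvariant (μ : LocalMeasure φ) : Prop :=
  ∀ b c : Fin n → U, tp L A b = tp L A c → μ.measure (fiber φ b) = μ.measure (fiber φ c)

open Classical in
/-- The fiber map `S_y(A) → [0,1]`, `q ↦ μ(φ(x, b))` for any `b ⊨ q`. It is meant for invariant `μ`
and `A` small, when each `q` is realized in `U` and the choice of `b` does not matter. -/
noncomputable def fiberMap (μ : LocalMeasure φ) (q : TypeSpace L A n) : ℝ :=
  if h : ∃ b : Fin n → U, tp L A b = q then μ.measure (fiber φ h.choose) else 0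

theorem fiberMap_tp {μ : LocalMeasure φ} (hμ : μ.IsInvariant) (b : Fin n → U) :
    μ.fiberMap (tp L A b) = μ.measure (fiber φ b) := by
  have h : ∃ c : Fin n → U, tp L A c = tp L A b := ⟨b, rfl⟩
  rw [fiberMap, dif_pos h]
  exact hμ _ _ h.choose_spec

/-- `μ` is `φ`-definable over `A`: it is `(A, φ)`-invariant and its fiber map is continuous. -/
def IsDefinable (μ : LocalMeasure φ) : Prop :=
  μ.IsInvariant ∧ Continuous μ.fiberMap

/-- `μ` is finitely satisfiable in `A`: every set in the algebra of positive measure has a point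
in `A^x`. -/
def IsFinitelySatisfiable (μ : LocalMeasure φ) : Prop :=
  ∀ s ∈ localAlgebra φ, 0 < μ.measure s → ∃ a : Fin m → U, (∀ j, a j ∈ A) ∧ a ∈ s

end LocalMeasure

end Formula

open Classical in
/-- `Av(a₁, …, a_N)(s)`: the proportion of the points `a₁, …, a_N` that lie in `s`. -/
noncomputable def av {X : Type w} {N : ℕ} (a : Fin N → X) (s : Set X) : ℝ :=
  ((Finset.univ.filter fun i => a i ∈ s).card : ℝ) / N

end LocalKeisler

/-! On the compact space `K = S_y(M)`, let `f` be the fiber map of `μ` and `g a` the indicator of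
`φ(a, y)` for `a ∈ M^x`; all are continuous. Saturation realizes every type over `M`, so finite
satisfiability makes `f` agree on each finite subset of `K` with a convex combination of the `g a`,
and NIP, via Sauer–Shelah for the dual relation, gives the family `g` polynomial growth. These facts
suffice (`exists_uniform_average_approx`). If averages fail at `ε`, convex combinations fail at `ε /
2`. For each finite `A₀ ⊆ M^x`, minimax then gives a finitely supported mixture of signed points of
`K` on which every `g a`, `a ∈ A₀`, deviates from `f` by more than `ε / 2` on average. Rounding to a
large sample and repeatedly halving it gives a sample of size `2 ^ s` with mean deviation at least
`ε / 4`, where `s` depends only on the growth exponent and `ε`. Since `s` is fixed, compactness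
gives one sample that works for all `a`. But at its points `f` is a convex combination of the `g a`,
so a weighted mean of these deviations is `0`, a contradiction. -/

namespace LocalKeisler

/-! ### Rounding and random halving -/

/-- A finite convex combination is approximated by averages over `n` of its points, with an
error of order `1 / n` that is uniform over all functions bounded by `1`. -/
theorem exists_average_approx {ι : Type*} [Fintype ι] {wt : ι → ℝ} (h0 : ∀ i, 0 ≤ wt i)
    (h1 : ∑ i, wt i = 1) {n : ℕ} (hn : 0 < n) :
    ∃ z : Fin n → ι, ∀ v : ι → ℝ, (∀ i, |v i| ≤ 1) →
      |(∑ j, v (z j)) / n - ∑ i, wt i * v i| ≤ 2 * Fintype.card ι / n := by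
  classical
  have hne : Nonempty ι := by
    by_contra h
    rw [not_nonempty_iff] at h
    simp at h1
  obtain ⟨i₀⟩ := hne
  have hn' : (0 : ℝ) < n := by exact_mod_cast hn
  set k : ι → ℕ := fun i => ⌊(n : ℝ) * wt i⌋₊ with hk
  have hk1 : ∀ i, (k i : ℝ) ≤ n * wt i := fun i => Nat.floor_le (by have := h0 i; positivity)
  have hk2 : ∀ i, (n : ℝ) * wt i - k i ≤ 1 := fun i => by
    have := Nat.lt_floor_add_one ((n : ℝ) * wt i)
    simp only [hk]; linarith
  have hs : ∑ i, (n : ℝ) * wt i = n := by rw [← Finset.mul_sum, h1, mul_one]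
  have hle : ∑ i, k i ≤ n := by
    have : ((∑ i, k i : ℕ) : ℝ) ≤ n := by
      rw [Nat.cast_sum]
      exact (Finset.sum_le_sum fun i _ => hk1 i).trans hs.le
    exact_mod_cast this
  -- Rounding the multiplicities down leaves `r ≤ card ι` slots of the sample empty; all of them go
  -- to `i₀`.
  set r := n - ∑ i, k i with hr
  have hrR : (r : ℝ) = ∑ i, ((n : ℝ) * wt i - k i) := by
    rw [hr, Nat.cast_sub hle, Nat.cast_sum, Finset.sum_sub_distrib, hs]
  have hrle : (r : ℝ) ≤ Fintype.card ι := by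
    rw [hrR]
    refine (Finset.sum_le_sum fun i _ => hk2 i).trans (by simp)
  have hcard : Fintype.card ((Σ i, Fin (k i)) ⊕ Fin r) = n := by
    simp [hr]; omega
  let e : Fin n ≃ ((Σ i, Fin (k i)) ⊕ Fin r) := (Fintype.equivFinOfCardEq hcard).symm
  refine ⟨fun j => Sum.elim Sigma.fst (fun _ => i₀) (e j), fun v hv => ?_⟩
  have hsum : ∑ j, v (Sum.elim Sigma.fst (fun _ => i₀) (e j)) = ∑ i, k i * v i + r * v i₀ := by
    rw [Equiv.sum_comp e (fun x => v (Sum.elim Sigma.fst (fun _ => i₀) x)), Fintype.sum_sum_type,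
      Fintype.sum_sigma]
    simp
  have hdiff : (∑ i, k i * v i + r * v i₀) / n - ∑ i, wt i * v i
      = (r * v i₀ - ∑ i, ((n : ℝ) * wt i - k i) * v i) / n := by
    simp only [sub_mul, Finset.sum_sub_distrib]
    have : ∑ i, (n : ℝ) * wt i * v i = n * ∑ i, wt i * v i := by
      rw [Finset.mul_sum]; exact Finset.sum_congr rfl fun i _ => by ring
    rw [this]; field_simp; ring
  rw [hsum, hdiff, abs_div, abs_of_pos hn']
  gcongr
  have hA : |(r : ℝ) * v i₀| ≤ r := by
    rw [abs_mul, Nat.abs_cast]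
    exact mul_le_of_le_one_right (Nat.cast_nonneg _) (hv i₀)
  have hB : |∑ i, ((n : ℝ) * wt i - k i) * v i| ≤ r := by
    rw [hrR]
    refine (Finset.abs_sum_le_sum_abs _ _).trans (Finset.sum_le_sum fun i _ => ?_)
    have := sub_nonneg.2 (hk1 i)
    rw [abs_mul, abs_of_nonneg this]
    exact mul_le_of_le_one_right this (hv i)
  calc _ ≤ |(r : ℝ) * v i₀| + |∑ i, ((n : ℝ) * wt i - k i) * v i| := abs_sub _ _
    _ ≤ 2 * Fintype.card ι := by linarith

/-- From each pair `(i, false), (i, true)` one can choose a point such that, simultaneously for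
all vectors in a finite set, the sum over the chosen points is not much less than half of the
full sum. -/
theorem exists_half_sample {ι : Type*} [Fintype ι] (P : Finset (ι × Bool → ℝ))
    (hP : ∀ v ∈ P, ∀ x, |v x| ≤ 1) {l : ℝ} (hl : 0 < l) :
    ∃ σ : ι → Bool, ∀ v ∈ P, (∑ x, v x) / 2 - ∑ i, v (i, σ i) ≤
      Real.log P.card / l + l * Fintype.card ι / 2 := by
  classical
  let s : Bool → ℝ := fun b => if b then 1 else -1
  let d : (ι × Bool → ℝ) → ι → ℝ := fun v i => (v (i, true) - v (i, false)) / 2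
  have hd : ∀ v ∈ P, ∀ i, d v i ^ 2 ≤ 1 := fun v hv i => by
    have h1 := abs_le.1 (hP v hv (i, true))
    have h2 := abs_le.1 (hP v hv (i, false))
    rw [sq_le_one_iff_abs_le_one, abs_le]
    constructor <;> simp only [d] <;> linarith
  have key : ∀ (v : ι × Bool → ℝ) (σ : ι → Bool),
      (∑ x, v x) / 2 - ∑ i, v (i, σ i) = ∑ i, -(s (σ i) * d v i) := by
    intro v σ
    rw [Fintype.sum_prod_type, Finset.sum_div, ← Finset.sum_sub_distrib]
    refine Finset.sum_congr rfl fun i _ => ?_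
    cases h : σ i <;> simp [s, d] <;> ring
  -- Chernoff bound for uniform random signs: the exponential moment factors over `i`, and `cosh x ≤
  -- exp (x ^ 2 / 2)`.
  have hv : ∀ v ∈ P, ∑ σ : ι → Bool, Real.exp (l * ∑ i, -(s (σ i) * d v i)) ≤
      ∑ _σ : ι → Bool, Real.exp (l ^ 2 * Fintype.card ι / 2) := by
    intro v hv
    have h1 : ∀ σ : ι → Bool, Real.exp (l * ∑ i, -(s (σ i) * d v i)) =
        ∏ i, Real.exp (-(l * s (σ i) * d v i)) := fun σ => by
      rw [Finset.mul_sum, Real.exp_sum]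
      exact Finset.prod_congr rfl fun i _ => by ring_nf
    simp_rw [h1]
    rw [← Fintype.prod_sum (fun (i : ι) (b : Bool) => Real.exp (-(l * s b * d v i)))]
    have h2 : ∀ i, ∑ b, Real.exp (-(l * s b * d v i)) ≤ 2 * Real.exp (l ^ 2 / 2) := by
      intro i
      have := Real.cosh_le_exp_half_sq (l * d v i)
      have h3 : ∑ b, Real.exp (-(l * s b * d v i)) = 2 * Real.cosh (l * d v i) := by
        simp [s, Real.cosh_eq]; ring
      rw [h3]
      have h4 : (l * d v i) ^ 2 / 2 ≤ l ^ 2 / 2 := by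
        have := hd v hv i
        rw [mul_pow]; nlinarith [sq_nonneg l]
      have := Real.exp_le_exp.2 h4
      linarith
    calc _ ≤ ∏ _i : ι, 2 * Real.exp (l ^ 2 / 2) :=
          Finset.prod_le_prod (fun i _ => Finset.sum_nonneg fun _ _ => (Real.exp_pos _).le)
            fun i _ => h2 i
      _ = _ := by
        simp only [Finset.prod_const, Finset.sum_const, Finset.card_univ, Fintype.card_fun,
          Fintype.card_bool, nsmul_eq_mul, mul_pow, ← Real.exp_nat_mul]
        push_cast
        congr 2; ring
  have htot : ∑ σ : ι → Bool, ∑ v ∈ P, Real.exp (l * ∑ i, -(s (σ i) * d v i)) ≤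
      ∑ _σ : ι → Bool, P.card * Real.exp (l ^ 2 * Fintype.card ι / 2) := by
    rw [Finset.sum_comm]
    refine (Finset.sum_le_sum hv).trans (le_of_eq ?_)
    simp only [Finset.sum_const, nsmul_eq_mul]; ring
  -- Some `σ` does no worse than the mean of the total over `P`, and each `v ∈ P` contributes at
  -- most that total.
  obtain ⟨σ, -, hσ⟩ := Finset.exists_le_of_sum_le Finset.univ_nonempty htot
  refine ⟨σ, fun v hvP => ?_⟩
  rw [key]
  have h5 : Real.exp (l * ∑ i, -(s (σ i) * d v i)) ≤
      P.card * Real.exp (l ^ 2 * Fintype.card ι / 2) :=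
    (Finset.single_le_sum (f := fun v => Real.exp (l * ∑ i, -(s (σ i) * d v i)))
      (fun _ _ => (Real.exp_pos _).le) hvP).trans hσ
  have hc : (0 : ℝ) < P.card := by exact_mod_cast Finset.card_pos.2 ⟨v, hvP⟩
  rw [← Real.exp_log hc, ← Real.exp_add, Real.exp_le_exp] at h5
  rw [show Real.log P.card / l + l * Fintype.card ι / 2 =
    (Real.log P.card + l ^ 2 * Fintype.card ι / 2) / l by field_simp, le_div_iff₀ hl]
  linarith

/-! ### Subsamples of bounded size for families of polynomial growth -/

/-- The family `h` takes at most `(N + 1) ^ d` patterns on any `N` points. -/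
def HasPolynomialGrowth {A Y : Type*} (h : A → Y → ℝ) (d : ℕ) : Prop :=
  ∀ (N : ℕ) (y : Fin N → Y), (Set.range fun (a : A) (j : Fin N) => h a (y j)).Finite ∧
    (Set.range fun (a : A) (j : Fin N) => h a (y j)).ncard ≤ (N + 1) ^ d

/-- The error made when a sample of size `2 ^ (s + 1)` is halved. -/
noncomputable def halvingError (d s : ℕ) : ℝ := d * ((s + 2) * (2 / 3) ^ s) + (3 / 4) ^ s / 2

theorem summable_halvingError (d : ℕ) : Summable (halvingError d) := by
  have h1 : Summable fun s : ℕ => ((s : ℝ) ^ 1 * (2 / 3) ^ s) :=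
    summable_pow_mul_geometric_of_norm_lt_one 1 (by norm_num)
  have h2 : Summable fun s : ℕ => ((2 : ℝ) / 3) ^ s :=
    summable_geometric_of_lt_one (by norm_num) (by norm_num)
  have h3 : Summable fun s : ℕ => ((3 : ℝ) / 4) ^ s :=
    summable_geometric_of_lt_one (by norm_num) (by norm_num)
  refine (((h1.add (h2.mul_left 2)).mul_left (d : ℝ)).add (h3.mul_right (1 / 2))).congr fun s => ?_
  simp only [halvingError]; ring

variable {A Y : Type*} {h : A → Y → ℝ} {d : ℕ}

/-- Only the patterns on `y` matter, and their number has logarithm at most `d * (s + 2)`, so the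
loss is small even when `A` is infinite. -/
theorem HasPolynomialGrowth.exists_half (hd : HasPolynomialGrowth h d) (hb : ∀ a y, |h a y| ≤ 1)
    (s : ℕ) (y : Fin (2 ^ (s + 1)) → Y) :
    ∃ z : Fin (2 ^ s) → Y, ∀ a, (∑ j, h a (y j)) / 2 ^ (s + 1) - (∑ j, h a (z j)) / 2 ^ s ≤
      halvingError d s := by
  classical
  have hcard : Fintype.card (Fin (2 ^ s) × Bool) = 2 ^ (s + 1) := by simp [pow_succ]
  let e : Fin (2 ^ s) × Bool ≃ Fin (2 ^ (s + 1)) := Fintype.equivFinOfCardEq hcard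
  obtain ⟨hfin, hncard⟩ := hd _ y
  let P : Finset (Fin (2 ^ s) × Bool → ℝ) := hfin.toFinset.image fun u x => u (e x)
  have hPcard : P.card ≤ (2 ^ (s + 1) + 1) ^ d := by
    refine Finset.card_image_le.trans ?_
    rwa [← Set.ncard_eq_toFinset_card _ hfin]
  have hmem : ∀ a, (fun x => h a (y (e x))) ∈ P := fun a =>
    Finset.mem_image.2 ⟨fun j => h a (y j), by simp, rfl⟩
  have hP : ∀ v ∈ P, ∀ x, |v x| ≤ 1 := by
    intro v hv x
    obtain ⟨u, hu, rfl⟩ := Finset.mem_image.1 hv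
    obtain ⟨a, rfl⟩ := hfin.mem_toFinset.1 hu
    exact hb _ _
  -- After division by `2 ^ s` the two error terms are of order `s / (l * 2 ^ s)` and `l`; with `l =
  -- (3 / 4) ^ s` both are summable in `s`.
  obtain ⟨σ, hσ⟩ := exists_half_sample P hP (l := (3 / 4) ^ s) (by positivity)
  refine ⟨fun i => y (e (i, σ i)), fun a => ?_⟩
  have h1 := hσ _ (hmem a)
  have h2 : ∑ x, h a (y (e x)) = ∑ j, h a (y j) := Equiv.sum_comp e fun j => h a (y j)
  have hlog : Real.log P.card ≤ d * (s + 2) := by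
    have hpos : (0 : ℝ) < P.card := by exact_mod_cast Finset.card_pos.2 ⟨_, hmem a⟩
    have h3 : (P.card : ℝ) ≤ (2 ^ (s + 2)) ^ d := by
      have h4 : (2 ^ (s + 1) + 1) ^ d ≤ (2 ^ (s + 2)) ^ d := by
        refine Nat.pow_le_pow_left ?_ d
        have := Nat.one_le_two_pow (n := s + 1)
        rw [pow_succ 2 (s + 1)]; omega
      exact_mod_cast hPcard.trans h4
    refine (Real.log_le_log hpos h3).trans ?_
    rw [Real.log_pow, Real.log_pow]
    push_cast
    have := Real.log_two_lt_d9
    have : Real.log 2 ≤ 1 := by linarith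
    gcongr
    exact mul_le_of_le_one_right (by positivity) this
  simp only [h2, Fintype.card_fin] at h1
  have h5 : (∑ j, h a (y j)) / 2 ^ (s + 1) - (∑ i, h a (y (e (i, σ i)))) / 2 ^ s =
      ((∑ j, h a (y j)) / 2 - ∑ i, h a (y (e (i, σ i)))) / 2 ^ s := by
    rw [sub_div, div_div, ← pow_succ']
  rw [h5, div_le_iff₀ (by positivity)]
  refine h1.trans ?_
  have h6 : halvingError d s * 2 ^ s = d * (s + 2) / (3 / 4) ^ s + (3 / 4) ^ s * 2 ^ s / 2 := by
    simp only [halvingError]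
    rw [add_mul, div_pow, div_pow, show (4 : ℝ) ^ s = 2 ^ s * 2 ^ s by rw [← mul_pow]; norm_num]
    field_simp
  rw [h6]
  push_cast
  gcongr

theorem HasPolynomialGrowth.exists_subsample (hd : HasPolynomialGrowth h d)
    (hb : ∀ a y, |h a y| ≤ 1) {s t : ℕ} (hst : s ≤ t) (y : Fin (2 ^ t) → Y) :
    ∃ z : Fin (2 ^ s) → Y, ∀ a, (∑ j, h a (y j)) / 2 ^ t - (∑ j, h a (z j)) / 2 ^ s ≤
      ∑ i ∈ Finset.Ico s t, halvingError d i := by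
  induction t, hst using Nat.le_induction with
  | base => exact ⟨y, fun a => by simp⟩
  | succ t hst ih =>
    obtain ⟨y', hy'⟩ := hd.exists_half hb t y
    obtain ⟨z, hz⟩ := ih y'
    refine ⟨z, fun a => ?_⟩
    rw [Finset.sum_Ico_succ_top hst]
    linarith [hy' a, hz a]

/-- The tail bound is uniform in `t`, so the final sample size `2 ^ s` does not depend on the size
of the initial sample. -/
theorem exists_sum_halvingError_le (d : ℕ) {δ : ℝ} (hδ : 0 < δ) :
    ∃ s, ∀ t, ∑ i ∈ Finset.Ico s t, halvingError d i ≤ δ := by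
  obtain ⟨F, hF⟩ := summable_iff_vanishing.1 (summable_halvingError d) _ (Metric.ball_mem_nhds 0 hδ)
  refine ⟨F.sup id + 1, fun t => ?_⟩
  have h1 := hF (Finset.Ico (F.sup id + 1) t) (Finset.disjoint_left.2 fun i hi hiF => by
    have := Finset.le_sup (f := id) hiF
    simp only [Finset.mem_Ico, id] at hi this
    omega)
  rw [mem_ball_zero_iff, Real.norm_eq_abs] at h1
  exact (le_abs_self _).trans h1.le

/-! ### Minimax by separation of convex sets -/

/-- A finite-dimensional minimax principle: if every mixed strategy `wt` on the coordinates is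
beaten by a point of `S`, then a mixture of points of `S` beats all coordinates at once. -/
theorem exists_mem_convexHull_forall_lt {ι : Type*} [Fintype ι] {S : Set (ι → ℝ)}
    (hS : S.Nonempty) {c : ℝ}
    (H : ∀ wt : ι → ℝ, (∀ i, 0 ≤ wt i) → ∑ i, wt i = 1 → ∃ v ∈ S, c < ∑ i, wt i * v i) :
    ∃ v ∈ convexHull ℝ S, ∀ i, c < v i := by
  classical
  by_contra hcon
  push Not at hcon
  let O : Set (ι → ℝ) := Set.univ.pi fun _ => Set.Ioi c
  have hO : Convex ℝ O := convex_pi fun _ _ => convex_Ioi c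
  have hO' : IsOpen O := isOpen_set_pi Set.finite_univ fun _ _ => isOpen_Ioi
  have hdisj : Disjoint O (convexHull ℝ S) := Set.disjoint_left.2 fun v hv hvS => by
    obtain ⟨i, hi⟩ := hcon v hvS
    exact absurd (hv i trivial) (not_lt.2 hi)
  -- If no point of the hull works, a functional `l` separates it from the open orthant `O`: `l < b`
  -- on `O` and `b ≤ l` on the hull.
  obtain ⟨l, b, hl1, hl2⟩ := geometric_hahn_banach_open hO hO' (convex_convexHull ℝ S) hdisj
  have hl : ∀ v, l v = ∑ i, v i * l (Pi.single i 1) := fun v => by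
    conv_lhs => rw [pi_eq_sum_univ' v]
    rw [map_sum]
    refine Finset.sum_congr rfl fun i _ => ?_
    rw [map_smul, smul_eq_mul]
  have hlO : ∀ t : ℝ, c < t → t * ∑ i, l (Pi.single i 1) < b := fun t ht => by
    have := hl1 (fun _ => t) fun _ _ => ht
    rwa [hl, ← Finset.mul_sum] at this
  -- With a positive coefficient, moving inside `O` along coordinate `i` would raise `l` from `T` to
  -- exactly `b`.
  have hneg : ∀ i, l (Pi.single i 1) ≤ 0 := fun i => by
    by_contra hi
    push Not at hi
    set T := (c + 1) * ∑ j, l (Pi.single j 1)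
    have hT : T < b := hlO _ (by linarith)
    have h1 := hl1 ((fun _ => c + 1) + ((b - T) / l (Pi.single i 1)) • Pi.single i 1) fun j _ => by
      have : (0 : ℝ) ≤ (b - T) / l (Pi.single i 1) * (Pi.single i 1 : ι → ℝ) j := by
        refine mul_nonneg (div_nonneg (by linarith) hi.le) ?_
        by_cases hij : j = i
        · subst hij; simp
        · simp [hij]
      simp only [Pi.add_apply, Pi.smul_apply, smul_eq_mul, Set.mem_Ioi]
      linarith
    rw [map_add, map_smul, smul_eq_mul, div_mul_cancel₀ _ hi.ne', hl, ← Finset.mul_sum] at h1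
    linarith
  set W := ∑ i, l (Pi.single i 1) with hW
  have hW0 : W ≤ 0 := Finset.sum_nonpos fun i _ => hneg i
  -- If `W < 0`, the coefficients divided by `W` form a mixed strategy; the `v` beating it has the
  -- same `l`-value as the constant vector `l v / W`, which lies in `O`. If `W = 0`, then `l = 0`,
  -- which separates nothing.
  rcases hW0.lt_or_eq with hlt | heq
  · obtain ⟨v, hvS, hv⟩ := H (fun i => l (Pi.single i 1) / W)
      (fun i => div_nonneg_of_nonpos (hneg i) hW0)
      (by rw [← Finset.sum_div, ← hW, div_self hlt.ne])
    have h1 := hl2 v (subset_convexHull ℝ S hvS)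
    have h2 : ∑ i, l (Pi.single i 1) / W * v i = l v / W := by
      rw [hl, Finset.sum_div]
      exact Finset.sum_congr rfl fun i _ => by ring
    rw [h2, lt_div_iff_of_neg hlt] at hv
    have h3 : c < l v / W := (lt_div_iff_of_neg hlt).2 hv
    have h4 := hlO _ h3
    rw [div_mul_cancel₀ _ hlt.ne] at h4
    linarith
  · have hz : ∀ i, l (Pi.single i 1) = 0 := fun i =>
      (Finset.sum_eq_zero_iff_of_nonpos fun i _ => hneg i).1 heq i (Finset.mem_univ i)
    obtain ⟨v, hv⟩ := hS
    have h1 := hl2 v (subset_convexHull ℝ S hv)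
    have h2 := hlO (c + 1) (by linarith)
    rw [hl] at h1
    simp only [hz, mul_zero, Finset.sum_const_zero] at h1
    rw [heq] at h2
    linarith

/-! ### Signed deviations and uniform approximation -/

/-- The sign attached to a Boolean. -/
def boolSign (b : Bool) : ℝ := if b then 1 else -1

theorem abs_boolSign (b : Bool) : |boolSign b| = 1 := by cases b <;> simp [boolSign]

theorem exists_boolSign_mul_eq_abs (x : ℝ) : ∃ b, boolSign b * x = |x| := by
  rcases abs_choice x with h | h
  · exact ⟨true, by simp [boolSign, h]⟩
  · exact ⟨false, by simp [boolSign, h]⟩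

variable {K A : Type*} {f : K → ℝ} {g : A → K → ℝ}

/-- The signed deviation of `g a` from `f`. -/
def deviation (f : K → ℝ) (g : A → K → ℝ) (a : A) (x : Bool × K) : ℝ :=
  boolSign x.1 * (f x.2 - g a x.2)

theorem abs_deviation_le (hf : ∀ p, f p ∈ Set.Icc (0 : ℝ) 1) (hg : ∀ a p, g a p ∈ Set.Icc (0 : ℝ) 1)
    (a : A) (x : Bool × K) : |deviation f g a x| ≤ 1 := by
  have h1 := hf x.2
  have h2 := hg a x.2
  rw [deviation, abs_mul, abs_boolSign, one_mul, abs_le]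
  constructor <;> linarith [h1.1, h1.2, h2.1, h2.2]

/-- For fixed sample points, the pattern of deviations is a function of the pattern of `g`, so no
new patterns arise. -/
theorem HasPolynomialGrowth.deviation {d : ℕ} (hd : HasPolynomialGrowth g d) (f : K → ℝ) :
    HasPolynomialGrowth (deviation f g) d := by
  intro N y
  obtain ⟨h1, h2⟩ := hd N fun j => (y j).2
  let F : (Fin N → ℝ) → Fin N → ℝ := fun v j => boolSign (y j).1 * (f (y j).2 - v j)
  have h3 : (Set.range fun (a : A) (j : Fin N) => LocalKeisler.deviation f g a (y j)) =
      F '' Set.range fun (a : A) (j : Fin N) => g a (y j).2 := by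
    rw [← Set.range_comp]; rfl
  rw [h3]
  exact ⟨h1.image F, (Set.ncard_image_le h1).trans h2⟩

theorem continuous_deviation [TopologicalSpace K] (hf : Continuous f) (hg : ∀ a, Continuous (g a))
    (a : A) : Continuous (deviation f g a) := by
  have h1 : Continuous boolSign := continuous_of_discreteTopology
  have h2 := hg a
  unfold deviation
  fun_prop

theorem exists_average_near_combination (hg : ∀ a p, g a p ∈ Set.Icc (0 : ℝ) 1)
    {ι : Type*} [Fintype ι] {wt : ι → ℝ} (h0 : ∀ i, 0 ≤ wt i) (h1 : ∑ i, wt i = 1) (a : ι → A)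
    {δ : ℝ} (hδ : 0 < δ) :
    ∃ (N : ℕ) (_ : 0 < N) (b : Fin N → A), ∀ p,
      |(∑ j, g (b j) p) / N - ∑ i, wt i * g (a i) p| ≤ δ := by
  obtain ⟨N, hN⟩ := exists_nat_gt (2 * Fintype.card ι / δ)
  have hN0 : (0 : ℝ) < N := lt_of_le_of_lt (by positivity) hN
  have hN' : 0 < N := by exact_mod_cast hN0
  obtain ⟨z, hz⟩ := exists_average_approx h0 h1 hN'
  refine ⟨N, hN', fun j => a (z j), fun p => (hz (fun i => g (a i) p) fun i => ?_).trans ?_⟩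
  · rw [abs_of_nonneg (hg _ _).1]; exact (hg _ _).2
  · rw [div_le_iff₀ hN0]
    rw [div_lt_iff₀ hδ] at hN
    linarith

/-- The signs turn absolute deviations into linear ones, as minimax requires. One `δ` is lost in
rounding the mixture to `2 ^ t` points and one in subsampling to `2 ^ s`. -/
theorem exists_sample_deviation_ge {d : ℕ} (hf : ∀ p, f p ∈ Set.Icc (0 : ℝ) 1)
    (hg : ∀ a p, g a p ∈ Set.Icc (0 : ℝ) 1) [Nonempty K] (hd : HasPolynomialGrowth g d)
    {c δ : ℝ} (hδ : 0 < δ) {s : ℕ}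
    (hs : ∀ t, ∑ i ∈ Finset.Ico s t, halvingError d i ≤ δ) (A₀ : Finset A)
    (H : ∀ wt : A₀ → ℝ, (∀ i, 0 ≤ wt i) → ∑ i, wt i = 1 →
      ∃ p, c < |f p - ∑ i, wt i * g i p|) :
    ∃ z : Fin (2 ^ s) → Bool × K, ∀ a ∈ A₀, c - 2 * δ ≤ (∑ j, deviation f g a (z j)) / 2 ^ s := by
  have hS : (Set.range fun (x : Bool × K) (a : A₀) => deviation f g a x).Nonempty :=
    Set.range_nonempty _
  obtain ⟨v, hv, hvc⟩ := exists_mem_convexHull_forall_lt hS (c := c) fun wt h0 h1 => by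
    obtain ⟨p, hp⟩ := H wt h0 h1
    obtain ⟨b, hb⟩ := exists_boolSign_mul_eq_abs (f p - ∑ i, wt i * g i p)
    refine ⟨_, ⟨(b, p), rfl⟩, ?_⟩
    rw [← hb] at hp
    refine hp.trans_eq ?_
    have h2 : f p = ∑ i, wt i * f p := by rw [← Finset.sum_mul, h1, one_mul]
    rw [h2, ← Finset.sum_sub_distrib, Finset.mul_sum]
    exact Finset.sum_congr rfl fun i _ => by simp only [deviation]; ring
  rw [mem_convexHull_iff_exists_fintype] at hv
  obtain ⟨ι, _, wt, y, h0, h1, hy, rfl⟩ := hv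
  choose x hx using hy
  obtain ⟨t₀, ht₀⟩ := pow_unbounded_of_one_lt (2 * Fintype.card ι / δ) (one_lt_two)
  set t := max s t₀
  have ht : 2 * Fintype.card ι / δ < (2 : ℝ) ^ t :=
    ht₀.trans_le (pow_le_pow_right₀ one_le_two (le_max_right _ _))
  obtain ⟨w, hw⟩ := exists_average_approx h0 h1 (n := 2 ^ t) (by positivity)
  obtain ⟨z, hz⟩ := (hd.deviation f).exists_subsample (abs_deviation_le hf hg)
    (le_max_left s t₀) (fun j => x (w j))
  refine ⟨z, fun a ha => ?_⟩
  have h2 := hw (fun i => deviation f g a (x i)) fun i => abs_deviation_le hf hg a (x i)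
  have h3 : (2 * Fintype.card ι / (2 ^ t : ℕ) : ℝ) ≤ δ := by
    push_cast
    rw [div_le_iff₀ (by positivity)]
    rw [div_lt_iff₀ hδ] at ht
    linarith
  have h4 := hvc ⟨a, ha⟩
  have h5 : (∑ i, wt i • y i) ⟨a, ha⟩ = ∑ i, wt i * deviation f g a (x i) := by
    rw [Finset.sum_apply]
    exact Finset.sum_congr rfl fun i _ => by rw [← hx]; rfl
  rw [h5] at h4
  have h6 := (abs_le.1 (h2.trans h3)).1
  push_cast at h6
  have h7 := hz a
  have h8 := hs t
  linarith

/-- A continuous function on a compact space that agrees on every finite set with a convex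
combination of members of a family of continuous functions of polynomial growth is a uniform limit
of averages of members of the family. -/
theorem exists_uniform_average_approx [TopologicalSpace K] [CompactSpace K] [Nonempty K] {d : ℕ}
    (hf : ∀ p, f p ∈ Set.Icc (0 : ℝ) 1) (hg : ∀ a p, g a p ∈ Set.Icc (0 : ℝ) 1)
    (hfc : Continuous f) (hgc : ∀ a, Continuous (g a)) (hd : HasPolynomialGrowth g d)
    (hfin : ∀ (N : ℕ) (p : Fin N → K), ∃ (ι : Type) (_ : Fintype ι) (wt : ι → ℝ) (a : ι → A),
      (∀ i, 0 ≤ wt i) ∧ ∑ i, wt i = 1 ∧ ∀ j, f (p j) = ∑ i, wt i * g (a i) (p j))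
    {ε : ℝ} (hε : 0 < ε) :
    ∃ (N : ℕ) (_ : 0 < N) (a : Fin N → A), ∀ p, |f p - (∑ i, g (a i) p) / N| ≤ ε := by
  by_contra hcon
  have H : ∀ (A₀ : Finset A) (wt : A₀ → ℝ), (∀ i, 0 ≤ wt i) → ∑ i, wt i = 1 →
      ∃ p, ε / 2 < |f p - ∑ i, wt i * g i p| := by
    intro A₀ wt h0 h1
    by_contra! h
    obtain ⟨N, hN, b, hb⟩ := exists_average_near_combination hg h0 h1 Subtype.val (half_pos hε)
    refine hcon ⟨N, hN, b, fun p => ?_⟩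
    calc _ = |(f p - ∑ i, wt i * g i p) -
          ((∑ j, g (b j) p) / N - ∑ i, wt i * g i p)| := by congr 1; ring
      _ ≤ _ := abs_sub _ _
      _ ≤ ε := by linarith [h p, hb p]
  -- With `δ = ε / 8`, the bound `ε / 2 - 2 * δ` is `ε / 4`.
  obtain ⟨s, hs⟩ := exists_sum_halvingError_le d (δ := ε / 8) (by positivity)
  let C : A → Set (Fin (2 ^ s) → Bool × K) := fun a =>
    {z | ε / 4 ≤ (∑ j, deviation f g a (z j)) / 2 ^ s}
  have hC : ∀ a, IsClosed (C a) := fun a => by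
    have := continuous_deviation hfc hgc a
    exact isClosed_le continuous_const (by fun_prop)
  obtain ⟨z, hz⟩ := CompactSpace.iInter_nonempty hC fun A₀ => by
    obtain ⟨z, hz⟩ := exists_sample_deviation_ge hf hg hd (by positivity) hs A₀ (H A₀)
    refine ⟨z, Set.mem_iInter₂.2 fun a ha => ?_⟩
    have := hz a ha
    simp only [C, Set.mem_ofPred_eq]
    linarith
  rw [Set.mem_iInter] at hz
  obtain ⟨ι, _, wt, a, h0, h1, hp⟩ := hfin _ fun j => (z j).2
  have h2 : ∑ i, wt i * ((∑ j, deviation f g (a i) (z j)) / 2 ^ s) = 0 := by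
    simp_rw [mul_div_assoc', ← Finset.sum_div, Finset.mul_sum]
    rw [Finset.sum_comm, Finset.sum_eq_zero, zero_div]
    intro j _
    have h3 : ∀ i, wt i * deviation f g (a i) (z j) = boolSign (z j).1 *
        (wt i * f (z j).2 - wt i * g (a i) (z j).2) := fun i => by simp only [deviation]; ring
    simp_rw [h3]
    rw [← Finset.mul_sum, Finset.sum_sub_distrib, ← hp j, ← Finset.sum_mul, h1, one_mul, sub_self,
      mul_zero]
  have h4 : ∑ i, wt i * (ε / 4) ≤ ∑ i, wt i * ((∑ j, deviation f g (a i) (z j)) / 2 ^ s) :=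
    Finset.sum_le_sum fun i _ => mul_le_mul_of_nonneg_left (hz (a i)) (h0 i)
  rw [h2, ← Finset.sum_mul, h1] at h4
  linarith

/-! ### Sauer–Shelah -/

open Classical in
/-- The indicator of a relation, as a real-valued family. -/
noncomputable def relIndicator {A K : Type*} (R : A → K → Prop) (a : A) (p : K) : ℝ :=
  if R a p then 1 else 0

theorem relIndicator_mem_Icc {A K : Type*} (R : A → K → Prop) (a : A) (p : K) :
    relIndicator R a p ∈ Set.Icc (0 : ℝ) 1 := by
  unfold relIndicator; split_ifs <;> simp

/-- A form of the Sauer–Shelah lemma: a relation that shatters no finite set of more than `D`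
points has polynomial growth. -/
theorem hasPolynomialGrowth_relIndicator {A K : Type*} {R : A → K → Prop} {D : ℕ}
    (hD : ∀ (N : ℕ) (y : Fin N → K) (S : Finset (Fin N)),
      (∀ t ⊆ S, ∃ a, ∀ i ∈ S, R a (y i) ↔ i ∈ t) → S.card ≤ D) :
    HasPolynomialGrowth (relIndicator R) D := by
  classical
  intro N y
  let P : Finset (Finset (Fin N)) :=
    Finset.univ.filter fun t => ∃ a, ∀ i, R a (y i) ↔ i ∈ t
  let F : Finset (Fin N) → Fin N → ℝ := fun t j => if j ∈ t then 1 else 0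
  have hsub : (Set.range fun (a : A) (j : Fin N) => relIndicator R a (y j)) ⊆ P.image F := by
    rintro _ ⟨a, rfl⟩
    refine Finset.mem_coe.2 (Finset.mem_image.2
      ⟨Finset.univ.filter fun i => R a (y i), ?_, ?_⟩)
    · simp only [P, Finset.mem_filter, Finset.mem_univ, true_and]
      exact ⟨a, fun _ => Iff.rfl⟩
    · ext j
      simp [F, relIndicator]
  have hvc : P.vcDim ≤ D := Finset.sup_le fun S hS => hD N y S fun t ht => by
    obtain ⟨u, hu, rfl⟩ := Finset.mem_shatterer.1 hS ht
    simp only [P, Finset.mem_filter, Finset.mem_univ, true_and] at hu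
    obtain ⟨a, ha⟩ := hu
    exact ⟨a, fun i hi => by simp [ha i, hi]⟩
  have hP : P.card ≤ (N + 1) ^ D := by
    refine (Finset.card_le_card_shatterer P).trans
      (Finset.card_shatterer_le_sum_vcDim.trans ?_)
    calc ∑ k ∈ Finset.Iic P.vcDim, (Fintype.card (Fin N)).choose k
        ≤ ∑ k ∈ Finset.Iic D, (Fintype.card (Fin N)).choose k :=
          Finset.sum_le_sum_of_subset (Finset.Iic_subset_Iic.2 hvc)
      _ ≤ ∑ k ∈ Finset.range (D + 1), N ^ k := by
          rw [Fintype.card_fin, Nat.range_succ_eq_Iic]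
          exact Finset.sum_le_sum fun k _ => Nat.choose_le_pow _ _
      _ ≤ (N + 1) ^ D := by
          rw [add_pow]
          -- Termwise comparison with the binomial expansion: the coefficients are at least `1` for
          -- `k ≤ D`.
          refine Finset.sum_le_sum fun k hk => ?_
          rw [one_pow, mul_one]
          exact Nat.le_mul_of_pos_right _
            (Nat.choose_pos (Nat.lt_succ_iff.1 (Finset.mem_range.1 hk)))
  refine ⟨(P.image F).finite_toSet.subset hsub, ?_⟩
  refine (Set.ncard_le_ncard hsub (P.image F).finite_toSet).trans ?_
  rw [Set.ncard_coe_finset]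
  exact Finset.card_image_le.trans hP

/-! ### Instances of the formula on the type space -/

section

variable {L : FirstOrder.Language.{u, v}} {U : Type w} [L.Structure U]
  {A : Set U} {m n : ℕ}

/-- The formula `φ(a, y)`, as a sentence with constants for `A` and for the variables `y`. -/
noncomputable def instanceSentence (φ : L[[A]].Formula (Fin m ⊕ Fin n)) (a : Fin m → A) :
    L[[A]][[Fin n]].Sentence :=
  Formula.equivSentence (BoundedFormula.subst φ
    (Sum.elim (fun j => (L.con (a j)).term) Term.var) : L[[A]].Formula (Fin n))

theorem instanceSentence_mem_tp [Nonempty U] (φ : L[[A]].Formula (Fin m ⊕ Fin n)) (a : Fin m → A)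
    (b : Fin n → U) :
    instanceSentence φ a ∈ tp L A b ↔ (fun j => (a j : U)) ∈ fiber φ b := by
  rw [instanceSentence, tp, Theory.CompleteType.formula_mem_typeOf, Formula.Realize,
    BoundedFormula.realize_subst, fiber, Set.mem_ofPred_eq, Formula.Realize]
  refine iff_of_eq (congrArg (fun v => BoundedFormula.Realize φ v default) ?_)
  funext x
  cases x with
  | inl j => exact Term.realize_con
  | inr j => rfl

/-- The relation `φ(a, y) ∈ q` between `A`-points `a` and types `q` over `A`. -/
def typeRel (φ : L[[A]].Formula (Fin m ⊕ Fin n)) (a : Fin m → A) (q : TypeSpace L A n) : Prop :=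
  instanceSentence φ a ∈ q

theorem continuous_relIndicator_typeRel (φ : L[[A]].Formula (Fin m ⊕ Fin n)) (a : Fin m → A) :
    Continuous (relIndicator (typeRel φ) a) := by
  classical
  have h := (IsClopen.continuous_indicator (s := Theory.typesWith _ (instanceSentence φ a))
    (CompleteType.isClopen_typesWith _) (f := fun _ : TypeSpace L A n => (1 : ℝ))
    continuous_const)
  refine h.congr fun q => ?_
  by_cases hq : instanceSentence φ a ∈ q
  · simp [relIndicator, typeRel, hq]
  · simp [relIndicator, typeRel, hq]

/-- The dual family of an NIP formula has polynomial growth on the type space. -/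
theorem IsNIP.exists_hasPolynomialGrowth [Nonempty U] {φ : L[[A]].Formula (Fin m ⊕ Fin n)} (hφ : IsNIP φ)
    (hreal : ∀ q : TypeSpace L A n, ∃ b : Fin n → U, tp L A b = q) :
    ∃ d, HasPolynomialGrowth (relIndicator (typeRel φ)) d := by
  classical
  obtain ⟨k, hk⟩ := hφ
  refine ⟨2 ^ k, hasPolynomialGrowth_relIndicator fun N y S hS => ?_⟩
  by_contra hlt
  apply hk
  have hcard : Fintype.card (Set (Fin k)) ≤ Fintype.card S := by
    rw [Fintype.card_set, Fintype.card_fin, Fintype.card_coe]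
    omega
  -- Dual shattering: label points of `S` by the subsets `I` of `Fin k`, and let `a i` satisfy `φ`
  -- exactly at those `I` containing `i`. Realizations of these types then shatter the `a i`.
  obtain ⟨e⟩ := Function.Embedding.nonempty_of_card_le hcard
  have h1 : ∀ i : Fin k, ∃ a, ∀ I, typeRel φ a (y (e I)) ↔ i ∈ I := fun i => by
    obtain ⟨a, ha⟩ := hS (Finset.univ.filter fun s => ∃ I, (e I : Fin N) = s ∧ i ∈ I) (by
      intro s hs
      obtain ⟨I, rfl, -⟩ := (Finset.mem_filter.1 hs).2
      exact (e I).2)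
    refine ⟨a, fun I => (ha _ (e I).2).trans ?_⟩
    simp only [Finset.mem_filter, Finset.mem_univ, true_and]
    constructor
    · rintro ⟨J, hJ, hi⟩
      rwa [← e.injective (Subtype.ext hJ)]
    · exact fun hi => ⟨I, rfl, hi⟩
  choose a ha using h1
  refine ⟨fun i j => a i j, fun I => ?_⟩
  obtain ⟨b, hb⟩ := hreal (y (e I))
  refine ⟨b, fun i => ?_⟩
  rw [← instanceSentence_mem_tp, hb]
  exact ha i I

/-! ### Finitely satisfiable measures on finitely many fibers -/

namespace LocalMeasure

variable {φ : L[[A]].Formula (Fin m ⊕ Fin n)} (μ : LocalMeasure φ)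

theorem measure_nonneg (s : Set (Fin m → U)) : 0 ≤ μ.measure s := NNReal.coe_nonneg _

theorem measure_univ : μ.measure Set.univ = 1 := by
  rw [measure, μ.map_univ, NNReal.coe_one]

theorem measure_empty : μ.measure ∅ = 0 := by
  rw [measure, addContent_empty, NNReal.coe_zero]

theorem measure_union {s t : Set (Fin m → U)} (hs : s ∈ localAlgebra φ) (ht : t ∈ localAlgebra φ)
    (hst : Disjoint s t) : μ.measure (s ∪ t) = μ.measure s + μ.measure t := by
  rw [measure, addContent_union' hs ht (isSetAlgebra_generateSetAlgebra.union_mem hs ht) hst,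
    NNReal.coe_add]
  rfl

theorem measure_iUnion {ι : Type*} [Fintype ι] {s : ι → Set (Fin m → U)}
    (hs : ∀ i, s i ∈ localAlgebra φ) (hd : Pairwise fun i j => Disjoint (s i) (s j)) :
    μ.measure (⋃ i, s i) = ∑ i, μ.measure (s i) := by
  have hmem : ⋃ i, s i ∈ localAlgebra φ := by
    have h := isSetAlgebra_generateSetAlgebra.biUnion_mem Finset.univ fun i _ => hs i
    simp only [Finset.mem_univ, Set.iUnion_true] at h
    exact h
  rw [measure, addContent_iUnion hs hd hmem, NNReal.coe_sum]
  rfl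

theorem fiber_mem_localAlgebra (b : Fin n → U) : fiber φ b ∈ localAlgebra φ :=
  self_subset_generateSetAlgebra ⟨b, rfl⟩

theorem measure_fiber_mem_Icc (b : Fin n → U) : μ.measure (fiber φ b) ∈ Set.Icc (0 : ℝ) 1 := by
  refine ⟨μ.measure_nonneg _, ?_⟩
  have h := μ.measure_union (fiber_mem_localAlgebra b)
    (isSetAlgebra_generateSetAlgebra.compl_mem (fiber_mem_localAlgebra b)) disjoint_compl_right
  rw [Set.union_compl_self, measure_univ] at h
  linarith [μ.measure_nonneg (fiber φ b)ᶜ]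

/-- On finitely many fibers, a finitely satisfiable measure agrees with a convex combination of
Dirac measures at points of `A`. -/
theorem IsFinitelySatisfiable.exists_convex_combination {μ : LocalMeasure φ}
    (hμ : μ.IsFinitelySatisfiable) {N : ℕ} (b : Fin N → Fin n → U) :
    ∃ (wt : (Fin N → Prop) → ℝ) (a : (Fin N → Prop) → Fin m → A),
      (∀ i, 0 ≤ wt i) ∧ ∑ i, wt i = 1 ∧ ∀ j, μ.measure (fiber φ (b j)) =
        ∑ i, wt i * relIndicator (fun a j => (fun l => (a l : U)) ∈ fiber φ (b j)) (a i) j := by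
  classical
  -- The weights are the measures of the atoms of the algebra generated by the `N` fibers.
  let atom : (Fin N → Prop) → Set (Fin m → U) := fun I => {x | ∀ j, x ∈ fiber φ (b j) ↔ I j}
  have hatom : ∀ I, atom I ∈ localAlgebra φ := fun I => by
    have h1 : atom I = ⋂ j ∈ (Finset.univ : Finset (Fin N)),
        if I j then fiber φ (b j) else (fiber φ (b j))ᶜ := by
      ext x
      simp only [atom, Set.mem_ofPred_eq, Finset.mem_univ, Set.iInter_true, Set.mem_iInter]
      refine forall_congr' fun j => ?_
      by_cases hj : I j <;> simp [hj]
    rw [h1]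
    refine isSetAlgebra_generateSetAlgebra.biInter_mem _ fun j _ => ?_
    split_ifs
    · exact fiber_mem_localAlgebra _
    · exact isSetAlgebra_generateSetAlgebra.compl_mem (fiber_mem_localAlgebra _)
  have hdisj : Pairwise fun I J => Disjoint (atom I) (atom J) := fun I J hIJ =>
    Set.disjoint_left.2 fun x hI hJ => hIJ (funext fun j => propext ((hI j).symm.trans (hJ j)))
  have hex : ∀ I, ∃ a : Fin m → A, 0 < μ.measure (atom I) → (fun l => (a l : U)) ∈ atom I := by
    intro I
    by_cases hI : 0 < μ.measure (atom I)
    · obtain ⟨a, ha, haI⟩ := hμ _ (hatom I) hI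
      exact ⟨fun l => ⟨a l, ha l⟩, fun _ => haI⟩
    -- A null atom may have no point in `A`; since its weight is `0`, any point of `A^x` serves.
    · obtain ⟨a, ha, -⟩ := hμ _ isSetAlgebra_generateSetAlgebra.univ_mem
        (μ.measure_univ ▸ zero_lt_one)
      exact ⟨fun l => ⟨a l, ha l⟩, fun h => absurd h hI⟩
  choose a ha using hex
  refine ⟨fun I => μ.measure (atom I), a, fun I => μ.measure_nonneg _, ?_, fun j => ?_⟩
  · rw [← μ.measure_iUnion hatom hdisj, ← μ.measure_univ]
    congr 1
    exact Set.eq_univ_of_forall fun x =>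
      Set.mem_iUnion.2 ⟨fun j => x ∈ fiber φ (b j), fun _ => Iff.rfl⟩
  · have h2 : fiber φ (b j) = ⋃ I : Fin N → Prop, if I j then atom I else ∅ := by
      ext x
      rw [Set.mem_iUnion]
      constructor
      · exact fun hx => ⟨fun j => x ∈ fiber φ (b j), by rw [if_pos hx]; exact fun _ => Iff.rfl⟩
      · rintro ⟨I, hx⟩
        split_ifs at hx with hI
        · exact (hx j).2 hI
        · exact hx.elim
    rw [h2, μ.measure_iUnion]
    · refine Finset.sum_congr rfl fun I _ => ?_
      rcases (μ.measure_nonneg (atom I)).eq_or_lt with h0 | hpos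
      · split_ifs <;> simp [← h0, μ.measure_empty]
      · by_cases hI : I j <;> simp [relIndicator, (ha I hpos) j, hI, μ.measure_empty]
    · intro I
      split_ifs
      · exact hatom I
      · exact isSetAlgebra_generateSetAlgebra.empty_mem
    · intro I J hIJ
      have := hdisj hIJ
      split_ifs <;> simp [this]

end LocalMeasure

end

end LocalKeisler

/-! ### The main theorem -/

theorem mainTheorem4 {L : FirstOrder.Language.{u, v}} (hL : L.card ≤ ℵ₀)
    {U : Type w} [L.Structure U] [Nonempty U]
    (κ : Cardinal.{w}) (hκ : ℵ₀ < κ) (hU : LocalKeisler.IsSaturated L U κ)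
    (M : L.ElementarySubstructure U) (hM : #M < κ)
    {m n : ℕ} (φ : L[[(M : Set U)]].Formula (Fin m ⊕ Fin n))
    (hφ : LocalKeisler.IsNIP φ)
    (μ : LocalKeisler.LocalMeasure φ)
    (hdef : μ.IsDefinable) (hfs : μ.IsFinitelySatisfiable)
    (ε : ℝ) (hε : 0 < ε) :
    ∃ (N : ℕ) (_ : 0 < N) (a : Fin N → Fin m → U), (∀ i j, a i j ∈ M) ∧
      BddAbove (Set.range fun b : Fin n → U =>
        |μ.measure (LocalKeisler.fiber φ b) - LocalKeisler.av a (LocalKeisler.fiber φ b)|) ∧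
      (⨆ b : Fin n → U,
        |μ.measure (LocalKeisler.fiber φ b) -
          LocalKeisler.av a (LocalKeisler.fiber φ b)|) < ε := by
  classical
  have hreal : ∀ q : LocalKeisler.TypeSpace L (M : Set U) n,
      ∃ b : Fin n → U, LocalKeisler.tp L (M : Set U) b = q := hU M hM n
  have : Nonempty (LocalKeisler.TypeSpace L (M : Set U) n) :=
    ⟨LocalKeisler.tp L (M : Set U) fun _ => Classical.arbitrary U⟩
  obtain ⟨d, hd⟩ := hφ.exists_hasPolynomialGrowth hreal
  have hrel : ∀ (a : Fin m → (M : Set U)) (b : Fin n → U),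
      LocalKeisler.typeRel φ a (LocalKeisler.tp L (M : Set U) b) ↔
        (fun j => (a j : U)) ∈ LocalKeisler.fiber φ b :=
    LocalKeisler.instanceSentence_mem_tp φ
  obtain ⟨N, hN, a, ha⟩ := LocalKeisler.exists_uniform_average_approx (f := μ.fiberMap)
    (g := LocalKeisler.relIndicator (LocalKeisler.typeRel φ))
    (fun q => by
      obtain ⟨b, rfl⟩ := hreal q
      rw [LocalKeisler.LocalMeasure.fiberMap_tp hdef.1]
      exact μ.measure_fiber_mem_Icc b)
    (LocalKeisler.relIndicator_mem_Icc _) hdef.2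
    (LocalKeisler.continuous_relIndicator_typeRel φ) hd
    (fun N p => by
      choose b hb using fun j => hreal (p j)
      obtain ⟨wt, a, h0, h1, h2⟩ := hfs.exists_convex_combination b
      refine ⟨_, inferInstance, wt, a, h0, h1, fun j => ?_⟩
      rw [← hb j, LocalKeisler.LocalMeasure.fiberMap_tp hdef.1, h2 j]
      simp only [LocalKeisler.relIndicator, hrel])
    -- A pointwise bound by `ε / 2` keeps the supremum strictly below `ε`.
    (half_pos hε)
  have hle : ∀ b : Fin n → U, |μ.measure (LocalKeisler.fiber φ b) -
      LocalKeisler.av (fun i j => (a i j : U)) (LocalKeisler.fiber φ b)| ≤ ε / 2 := fun b => by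
    have h1 := ha (LocalKeisler.tp L (M : Set U) b)
    rw [LocalKeisler.LocalMeasure.fiberMap_tp hdef.1] at h1
    simp only [LocalKeisler.relIndicator, hrel, Finset.sum_boole] at h1
    rw [LocalKeisler.av]
    convert h1
  refine ⟨N, hN, fun i j => a i j, fun i j => (a i j).2, ⟨ε / 2, ?_⟩, ?_⟩
  · rintro _ ⟨b, rfl⟩
    exact hle b
  · exact (ciSup_le hle).trans_lt (half_lt_self hε)
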